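/- Let $R$ be a (commutative) Noetherian ring, $\mathfrak m$ a maximal ideal of $R$, $I$ an ideal of $R$, and $M$ a finitely generated $R$-module of finite Krull dimension $d=\dim M$ (this is automatic if $R$ is local; for $M=0$ put $d=0$). Write $\ell$ for length and $H^0_{\mathfrak m}(N)=\{x\in N : \mathfrak m^k x=0 \text{ for some } k\}$. (1) Let $M=M_0\supseteq M_1\supseteq M_2\supseteq\cdots$ be a filtration by submodules which makes $M$ an $I$-filtered module, i.e. $IM_n\subseteq M_{n+1}$ for all $n$ and $\bigoplus_{n\ge 0} M_n$ is a finitely generated module over the Rees ring $\bigoplus_{n\ge 0} I^n$. Then $\ell\big(H^0_{\mathfrak m}(M/M_n)\big)$ is finite for every $n$, and $$\ell\big(H^0_{\mathfrak m}(M/M_n)\big)=O(n^{d})\qquad (n\to\infty).$$ (2) In particular, the $\varepsilon$-multiplicity is finite: $$\varepsilon(I,M)=\limsup_{n\to\infty}\frac{d!\,\ell\big(H^0_{\mathfrak m}(M/I^nM)\big)}{n^{d}}<\infty .$$ -/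

import Mathlib

open Filter Asymptotics
open scoped ENNReal Nat

/-- An `I`-filtration `M = M₀ ⊇ M₁ ⊇ ⋯` (with `I Mₙ ⊆ Mₙ₊₁`) makes `M` an `I`-filtered module if
`M₀ = M` and `⨁ Mₙ` is a finitely generated module over the Rees ring `⨁ Iⁿ`. Here `F.submodule`
is `⨁ Mₙ`, realised inside `M[t]` as a module over the Rees algebra `R[It] ⊆ R[t]`. -/
structure Ideal.Filtration.IsFilteredModule {R M : Type*} [CommRing R] [AddCommGroup M] [Module R M]
    {I : Ideal R} (F : I.Filtration M) : Prop where
  zero_eq_top : F.N 0 = ⊤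
  fg : F.submodule.FG

/-- The zeroth local cohomology `H⁰_J(N) = Γ_J(N)`: the submodule of all elements of `N` that are
annihilated by some power of the ideal `J`. -/
def zerothLocalCohomology {R : Type*} [CommRing R] (J : Ideal R) (N : Type*) [AddCommGroup N]
    [Module R N] : Submodule R N where
  carrier := {x | ∃ k : ℕ, ∀ a ∈ J ^ k, a • x = 0}
  zero_mem' := ⟨0, fun a _ => smul_zero a⟩
  add_mem' := by
    rintro x y ⟨k, hk⟩ ⟨l, hl⟩
    refine ⟨k + l, fun a ha => ?_⟩
    rw [smul_add, hk a (Ideal.pow_le_pow_right (Nat.le_add_right k l) ha),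
      hl a (Ideal.pow_le_pow_right (Nat.le_add_left l k) ha), add_zero]
  smul_mem' := by
    rintro r x ⟨k, hk⟩
    exact ⟨k, fun a ha => by rw [smul_comm, hk a ha, smul_zero]⟩

/-- The Krull dimension of (the support of) `M` as a natural number. It is the true dimension
whenever `M` is nonzero of finite dimension; the zero module gets the value `0`. -/
noncomputable def natDim (R M : Type*) [CommRing R] [AddCommGroup M] [Module R M] : ℕ :=
  ((Module.supportDim R M).unbotD 0).toNat

/-- The `ε`-multiplicity `limsup d! · ℓ(H⁰_𝔪(M / Iⁿ M)) / n ^ d`, `d = dim M`, with values in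
`[0, ∞]`. -/
noncomputable def epsilonMultiplicity {R : Type*} [CommRing R] (𝔪 I : Ideal R) (M : Type*)
    [AddCommGroup M] [Module R M] : ℝ≥0∞ :=
  limsup (fun n : ℕ =>
    ((natDim R M)! : ℝ≥0∞) *
      (Module.length R (zerothLocalCohomology 𝔪 (M ⧸ (I ^ n • (⊤ : Submodule R M)))) : ℝ≥0∞) /
        (n : ℝ≥0∞) ^ natDim R M) atTop

/-!
For an `I`-filtered module `M = M₀ ⊇ M₁ ⊇ ⋯`, the length of `H⁰_𝔪(M / Mₙ)` is compared with that of
`M / 𝔪 ^ (c * n) M` for a constant `c`, and the latter is bounded by a Hilbert–Samuel estimate.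

The comparison rests on the Artin–Rees lemma over the Rees algebra of `I`. The elements `x ∈ Mᵢ`
with `𝔪 ^ k x ⊆ Mᵢ₊₁` for some `k` form, over all `i`, a submodule of the Noetherian module `⨁ Mᵢ`,
and one `k` serves for all of them. Artin–Rees for this submodule and the extension of `𝔪` yields
`c` such that, for every `i`, such an `x` lying in `𝔪 ^ K Mᵢ` with `K ≥ c` already lies in
`𝔪 ^ (K - c) Mᵢ₊₁` (`Ideal.Filtration.exists_torsion_mem_pow_smul`). Starting from
`𝔪 ^ (c * n) M` and applying this `n` times, an element that is `𝔪`-power torsion modulo `Mₙ` ends up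
in `Mₙ` (`Ideal.Filtration.exists_torsion_mem_of_mem_pow_smul`). Therefore `H⁰_𝔪(M / Mₙ)` embeds in
a quotient of `M / 𝔪 ^ (c * n) M` (`length_zerothLocalCohomology_quotient_le`).

The estimate `ℓ(M / 𝔪 ^ n M) ≤ C * n ^ dim M` (`Module.exists_length_quotient_pow_smul_le`) is proved
by adjoining parameters one at a time: multiplication by `x ∈ 𝔪` gives
`ℓ(M / 𝔪 ^ (n + 1) M) ≤ ℓ(M / (x M + 𝔪 ^ (n + 1) M)) + ℓ(M / 𝔪 ^ n M)`, so each parameter raises the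
exponent by one. At most `dim M` parameters suffice, since a prime of a Noetherian ring is minimal
over an ideal generated by as many elements as its height. No localization of `M` is needed: a
statement that holds locally at `𝔪` holds modulo every power of `𝔪`.
-/

/-! ### Uniform Artin–Rees for torsion modulo a filtration -/

namespace Ideal.Filtration

variable {R M : Type*} [CommRing R] [AddCommGroup M] [Module R M] {I : Ideal R}

/-- The filtration `i ↦ {x ∈ Mᵢ | J x ⊆ Mᵢ₊₁}`: in degree `i` it consists of the elements whose
class in the associated graded piece `Mᵢ / Mᵢ₊₁` is killed by `J`. It is not shifted, so that it
gives a submodule of `⨁ Mᵢ`. -/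
def succColon (F : I.Filtration M) (J : Ideal R) : I.Filtration M where
  N i :=
    { carrier := {x | x ∈ F.N i ∧ ∀ a ∈ J, a • x ∈ F.N (i + 1)}
      zero_mem' := ⟨zero_mem _, fun a _ => by simp⟩
      add_mem' := fun {x y} hx hy => ⟨add_mem hx.1 hy.1, fun a ha => by
        rw [smul_add]; exact add_mem (hx.2 a ha) (hy.2 a ha)⟩
      smul_mem' := fun r x hx => ⟨Submodule.smul_mem _ _ hx.1, fun a ha => by
        rw [smul_comm]; exact Submodule.smul_mem _ _ (hx.2 a ha)⟩ }
  mono i x hx := ⟨F.mono i hx.1, fun a _ => Submodule.smul_mem _ _ hx.1⟩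
  smul_le i := Submodule.smul_le.mpr fun r hr x hx =>
    ⟨F.smul_le i (Submodule.smul_mem_smul hr hx.1), fun a ha => by
      rw [smul_comm]; exact F.smul_le (i + 1) (Submodule.smul_mem_smul hr (hx.2 a ha))⟩

/-- The filtration `i ↦ J Mᵢ`. -/
def idealSMul (F : I.Filtration M) (J : Ideal R) : I.Filtration M where
  N i := J • F.N i
  mono i := smul_mono_right _ (F.mono i)
  smul_le i := by
    rw [← Submodule.mul_smul, mul_comm, Submodule.mul_smul]
    exact smul_mono_right _ (F.smul_le i)

theorem coeff_algebraMap_smul (r : R) (f : PolynomialModule R M) (i : ℕ) :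
    (algebraMap R (reesAlgebra I) r • f).coeff i = r • f.coeff i := by
  have h : algebraMap R (reesAlgebra I) r • f = Polynomial.monomial 0 r • f := rfl
  rw [h, PolynomialModule.monomial_smul_apply]
  simp

theorem map_algebraMap_smul_submodule_le (F : I.Filtration M) (J : Ideal R) :
    J.map (algebraMap R (reesAlgebra I)) • F.submodule ≤ (F.idealSMul J).submodule := by
  have h : J.map (algebraMap R (reesAlgebra I)) ≤
      (F.idealSMul J).submodule.colon (F.submodule : Set (PolynomialModule R M)) := by
    rw [Ideal.map_le_iff_le_comap]
    intro r hr
    rw [Ideal.mem_comap, Submodule.mem_colon]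
    intro f hf i
    rw [coeff_algebraMap_smul]
    exact Submodule.smul_mem_smul hr (hf i)
  exact Submodule.smul_le.mpr fun a ha f hf => Submodule.mem_colon.mp (h ha) f hf

theorem single_mem_map_algebraMap_smul (F : I.Filtration M) (J : Ideal R) {i : ℕ} {x : M}
    (hx : x ∈ J • F.N i) :
    PolynomialModule.single R i x ∈ J.map (algebraMap R (reesAlgebra I)) • F.submodule := by
  induction hx using Submodule.smul_induction_on' with
  | smul r hr y hy =>
    have h : PolynomialModule.single R i (r • y) =
        algebraMap R (reesAlgebra I) r • PolynomialModule.single R i y := by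
      apply PolynomialModule.coeff_injective
      ext j
      rw [coeff_algebraMap_smul, PolynomialModule.coeff_single, PolynomialModule.coeff_single,
        Finsupp.single_apply, Finsupp.single_apply]
      split_ifs <;> simp
    rw [h]
    refine Submodule.smul_mem_smul (Ideal.mem_map_of_mem _ hr) fun j => ?_
    rw [PolynomialModule.coeff_single, Finsupp.single_apply]
    split_ifs with hij
    · exact hij ▸ hy
    · exact zero_mem _
  | add x _ y _ hx hy =>
    rw [PolynomialModule.single_add]
    exact add_mem hx hy

/-- A uniform Artin–Rees statement for torsion in the associated graded module. The classes in
`⨁ Mᵢ / Mᵢ₊₁` killed by a power of `J` lift to a submodule of the Noetherian module `⨁ Mᵢ`, and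
the Artin–Rees constant of that submodule over the Rees algebra serves all degrees `i` at once. -/
theorem exists_torsion_mem_pow_smul [IsNoetherianRing R] (F : I.Filtration M)
    (hF : F.submodule.FG) (J : Ideal R) :
    ∃ c : ℕ, ∀ i K : ℕ, c ≤ K → ∀ x ∈ J ^ K • F.N i,
      (∃ k : ℕ, ∀ a ∈ J ^ k, a • x ∈ F.N (i + 1)) → x ∈ J ^ (K - c) • F.N (i + 1) := by
  have : IsNoetherian (reesAlgebra I) F.submodule := isNoetherian_of_fg_of_noetherian _ hF
  let T : ℕ →o Submodule (reesAlgebra I) F.submodule :=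
    { toFun := fun k => (F.succColon (J ^ k)).submodule.comap F.submodule.subtype
      monotone' := fun k l hkl f hf i =>
        ⟨(hf i).1, fun a ha => (hf i).2 a (Ideal.pow_le_pow_right hkl ha)⟩ }
  -- A single power `J ^ t` kills all the `J`-power torsion of `⨁ Mᵢ / Mᵢ₊₁`.
  obtain ⟨t, ht⟩ := monotone_stabilizes_iff_noetherian.mpr this T
  obtain ⟨k, hk⟩ := (J.map (algebraMap R (reesAlgebra I))).exists_pow_inf_eq_pow_smul
    (M := F.submodule) (T t)
  refine ⟨k + t, fun i K hK x hx ⟨l, hl⟩ => ?_⟩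
  have hxF : x ∈ F.N i := Submodule.smul_le_right hx
  have hs : PolynomialModule.single R i x ∈ F.submodule := fun j => by
    rw [PolynomialModule.coeff_single, Finsupp.single_apply]
    split_ifs with hij
    · exact hij ▸ hxF
    · exact zero_mem _
  have hT : (⟨_, hs⟩ : F.submodule) ∈ T t := by
    have hmem : (⟨_, hs⟩ : F.submodule) ∈ T (max t l) := fun j => by
      change (PolynomialModule.single R i x).coeff j ∈ _
      rw [PolynomialModule.coeff_single, Finsupp.single_apply]
      split_ifs with hij
      · subst hij
        exact ⟨hxF, fun a ha => hl a (Ideal.pow_le_pow_right (le_max_right _ _) ha)⟩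
      · exact zero_mem _
    rwa [← ht _ (le_max_left _ _)] at hmem
  have hpow : (⟨_, hs⟩ : F.submodule) ∈
      (J.map (algebraMap R (reesAlgebra I))) ^ K • (⊤ : Submodule (reesAlgebra I) F.submodule) := by
    have h := F.single_mem_map_algebraMap_smul (J ^ K) hx
    rw [Ideal.map_pow, ← F.submodule.range_subtype, LinearMap.range_eq_map,
      ← Submodule.map_smul''] at h
    obtain ⟨y, hy, hyx⟩ := h
    rwa [show y = ⟨_, hs⟩ from Subtype.ext hyx] at hy
  have hAR := (hk K (by omega)).le ⟨hpow, hT⟩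
  have hmap : PolynomialModule.single R i x ∈
      ((F.succColon (J ^ t)).idealSMul (J ^ (K - k))).submodule := by
    apply map_algebraMap_smul_submodule_le
    have h := Submodule.mem_map_of_mem (f := F.submodule.subtype)
      (Submodule.smul_mono le_rfl inf_le_right hAR)
    rw [Submodule.map_smul'', ← Ideal.map_pow] at h
    exact Submodule.smul_mono le_rfl (Submodule.map_comap_le _ _) h
  have hi := hmap i
  rw [PolynomialModule.coeff_single, Finsupp.single_eq_same] at hi
  change x ∈ J ^ (K - k) • (F.succColon (J ^ t)).N i at hi
  rw [show K - k = (K - (k + t)) + t by omega, pow_add, Submodule.mul_smul] at hi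
  have hle : J ^ t • (F.succColon (J ^ t)).N i ≤ F.N (i + 1) :=
    Submodule.smul_le.mpr fun a ha y hy => hy.2 a ha
  exact Submodule.smul_mono le_rfl hle hi

/-- The `J`-power torsion of `M / Mₙ` meets `J ^ (c * n) (M / Mₙ)` trivially, with `c` independent
of `n`: an element of this intersection descends from `Mᵢ` to `Mᵢ₊₁` at the cost of `c` powers of
`J`, and `n` steps lead into `Mₙ`. -/
theorem exists_torsion_mem_of_mem_pow_smul [IsNoetherianRing R] (F : I.Filtration M)
    (hF : F.submodule.FG) (hF₀ : F.N 0 = ⊤) (J : Ideal R) :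
    ∃ c : ℕ, ∀ n : ℕ, ∀ x ∈ J ^ (c * n) • (⊤ : Submodule R M),
      (∃ k : ℕ, ∀ a ∈ J ^ k, a • x ∈ F.N n) → x ∈ F.N n := by
  obtain ⟨c, hc⟩ := F.exists_torsion_mem_pow_smul hF J
  refine ⟨c, fun n x hx ⟨k, hk⟩ => ?_⟩
  have key : ∀ i ≤ n, x ∈ J ^ (c * (n - i)) • F.N i := by
    intro i hi
    induction i with
    | zero => simpa [hF₀] using hx
    | succ i ih =>
      have h := hc i (c * (n - i)) (Nat.le_mul_of_pos_right c (by omega)) x (ih (by omega))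
        ⟨k, fun a ha => F.antitone hi (hk a ha)⟩
      rwa [← Nat.mul_sub_one, Nat.sub_sub] at h
  exact Submodule.smul_le_right (key n le_rfl)

end Ideal.Filtration

/-! ### The Hilbert–Samuel bound -/

section Length

variable {R M : Type*} [CommRing R] [AddCommGroup M] [Module R M]

theorem Module.length_quotient_anti {A B : Submodule R M} (h : A ≤ B) :
    Module.length R (M ⧸ B) ≤ Module.length R (M ⧸ A) :=
  Module.length_le_of_surjective (Submodule.factor h) (Submodule.factor_surjective h)

/-- Length is subadditive along the right exact sequence `M/B → M/A → M/(A + xM) → 0` whose first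
map is multiplication by `x`. -/
theorem Module.length_quotient_le_add (A B : Submodule R M) (x : R)
    (h : ∀ y ∈ B, x • y ∈ A) :
    Module.length R (M ⧸ A) ≤
      Module.length R (M ⧸ (A ⊔ Ideal.span {x} • (⊤ : Submodule R M))) +
        Module.length R (M ⧸ B) := by
  let f : (M ⧸ B) →ₗ[R] (M ⧸ A) := Submodule.mapQ B A (LinearMap.lsmul R M x) h
  rw [Module.length_eq_add_of_exact (LinearMap.range f).subtype (LinearMap.range f).mkQ
    (Submodule.subtype_injective _) (Submodule.mkQ_surjective _)
    (LinearMap.exact_subtype_mkQ _), add_comm]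
  refine add_le_add ?_ (Module.length_le_of_surjective f.rangeRestrict f.surjective_rangeRestrict)
  have hle : A ⊔ Ideal.span {x} • (⊤ : Submodule R M) ≤
      LinearMap.ker ((LinearMap.range f).mkQ ∘ₗ A.mkQ) := by
    refine sup_le (fun y hy => ?_) ?_
    · simp [(Submodule.Quotient.mk_eq_zero A).mpr hy]
    · rw [Submodule.ideal_span_singleton_smul]
      rintro _ ⟨y, -, rfl⟩
      exact (Submodule.Quotient.mk_eq_zero _).mpr ⟨B.mkQ y, rfl⟩
  refine Module.length_le_of_surjective (Submodule.liftQ _ _ hle) ?_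
  rw [← LinearMap.range_eq_top, Submodule.range_liftQ, LinearMap.range_eq_top]
  exact (Submodule.mkQ_surjective _).comp (Submodule.mkQ_surjective _)

theorem Module.length_quotient_pow_smul_top_ne_top [IsNoetherianRing R] [Module.Finite R M]
    (𝔪 : Ideal R) [𝔪.IsMaximal] (n : ℕ) :
    Module.length R (M ⧸ (𝔪 ^ n • (⊤ : Submodule R M))) ≠ ⊤ := by
  have : Ring.KrullDimLE 0 (R ⧸ 𝔪 ^ n) := Ring.krullDimLE_zero_iff.mpr fun J hJ => by
    have hJ' : (J.comap (Ideal.Quotient.mk (𝔪 ^ n))).IsPrime := hJ.comap _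
    have hle : 𝔪 ^ n ≤ J.comap (Ideal.Quotient.mk (𝔪 ^ n)) :=
      le_trans (by simp) (Ideal.ker_le_comap _)
    have heq := Ideal.IsMaximal.eq_of_le ‹_› hJ'.ne_top (hJ'.le_of_pow_le hle)
    exact Ideal.isMaximal_of_isIntegral_of_isMaximal_comap _ (heq ▸ ‹𝔪.IsMaximal›)
  have : IsArtinianRing (R ⧸ 𝔪 ^ n) := IsNoetherianRing.isArtinianRing_of_krullDimLE_zero
  have : Module.Finite (R ⧸ 𝔪 ^ n) (M ⧸ (𝔪 ^ n • (⊤ : Submodule R M))) :=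
    Module.Finite.of_restrictScalars_finite R _ _
  rw [Module.length_eq_of_surjective (S := R) (R := R ⧸ 𝔪 ^ n) Ideal.Quotient.mk_surjective]
  exact Module.length_ne_top

/-- The upper bound for a Hilbert–Samuel function by the number of parameters: if the elements of
`s` cut `M / L` down to something on which the powers of `𝔪` become stationary, the length of
`M / (L + 𝔪 ^ n M)` grows at most like `n ^ #s`. Each parameter contributes one summation over `n`.
The submodule `L` varies so that the induction can absorb a parameter into it. -/
theorem Module.exists_length_quotient_sup_pow_smul_le [IsNoetherianRing R] [Module.Finite R M]
    (𝔪 : Ideal R) [𝔪.IsMaximal] (t : ℕ) (s : Finset R) (hs : ∀ x ∈ s, x ∈ 𝔪)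
    (L : Submodule R M)
    (h : ∀ N : ℕ, 𝔪 ^ t • (⊤ : Submodule R M) ≤
      L ⊔ Ideal.span (s : Set R) • ⊤ ⊔ 𝔪 ^ N • ⊤) :
    ∃ C : ℕ, ∀ n : ℕ,
      Module.length R (M ⧸ (L ⊔ 𝔪 ^ n • (⊤ : Submodule R M))) ≤ ((C * n ^ s.card : ℕ) : ℕ∞) := by
  classical
  induction s using Finset.induction_on generalizing L with
  | empty =>
    refine ⟨(Module.length R (M ⧸ (𝔪 ^ t • (⊤ : Submodule R M)))).toNat, fun n => ?_⟩
    rw [Finset.card_empty, pow_zero, mul_one,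
      ENat.natCast_toNat (Module.length_quotient_pow_smul_top_ne_top 𝔪 t)]
    exact Module.length_quotient_anti (by simpa using h n)
  | insert x s hx ih =>
    obtain ⟨C, hC⟩ := ih (fun y hy => hs y (Finset.mem_insert_of_mem hy))
      (L ⊔ Ideal.span {x} • ⊤) (fun N => by
        rw [sup_assoc L, ← Submodule.sup_smul, ← Ideal.span_union, Set.singleton_union,
          ← Finset.coe_insert]
        exact h N)
    refine ⟨C, fun n => ?_⟩
    induction n with
    | zero =>
      have : Subsingleton (M ⧸ (L ⊔ 𝔪 ^ 0 • (⊤ : Submodule R M))) := by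
        rw [Submodule.Quotient.subsingleton_iff]
        simp
      rw [Module.length_eq_zero]
      exact zero_le
    | succ n ihn =>
      have hmul : ∀ y ∈ L ⊔ 𝔪 ^ n • (⊤ : Submodule R M),
          x • y ∈ L ⊔ 𝔪 ^ (n + 1) • (⊤ : Submodule R M) := by
        intro y hy
        obtain ⟨a, ha, b, hb, rfl⟩ := Submodule.mem_sup.mp hy
        rw [smul_add]
        refine add_mem (Submodule.mem_sup_left (L.smul_mem x ha)) (Submodule.mem_sup_right ?_)
        rw [pow_succ', Submodule.mul_smul]
        exact Submodule.smul_mem_smul (hs x (Finset.mem_insert_self _ _)) hb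
      refine (Module.length_quotient_le_add _ _ x hmul).trans ?_
      rw [sup_right_comm]
      refine (add_le_add (hC (n + 1)) ihn).trans ?_
      rw [Finset.card_insert_of_notMem hx]
      norm_cast
      calc C * (n + 1) ^ s.card + C * n ^ (s.card + 1)
          ≤ C * (n + 1) ^ s.card + C * ((n + 1) ^ s.card * n) := by
            rw [pow_succ]; gcongr; omega
        _ = C * (n + 1) ^ (s.card + 1) := by ring

end Length

/-- A maximal ideal `p` that is minimal over `J` has a power that lies in `J` locally at `p`, hence
in `J` modulo every power of `p`. -/
theorem Ideal.exists_forall_pow_le_sup_pow {R : Type*} [CommRing R] [IsNoetherianRing R]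
    {p J : Ideal R} [hp : p.IsMaximal] (h : p ∈ J.minimalPrimes) :
    ∃ t : ℕ, ∀ N : ℕ, p ^ t ≤ J ⊔ p ^ N := by
  let A := Localization.AtPrime p
  have hr := IsLocalization.AtPrime.radical_map_of_mem_minimalPrimes (A := A) p J h
  obtain ⟨t, ht⟩ := Ideal.exists_pow_le_of_le_radical_of_fg hr.ge (IsNoetherian.noetherian _)
  refine ⟨t, fun N x hx => ?_⟩
  rw [← Ideal.map_pow] at ht
  obtain ⟨s, hs, hsx⟩ := (IsLocalization.algebraMap_mem_map_algebraMap_iff p.primeCompl A J x).mp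
    (ht (Ideal.mem_map_of_mem _ hx))
  -- `s` is invertible modulo `p ^ N`.
  have htop : Ideal.span {s} ⊔ p ^ N = ⊤ := by
    apply Ideal.sup_pow_eq_top
    obtain ⟨y, z, hz, hyz⟩ := hp.exists_inv hs
    rw [Ideal.eq_top_iff_one, ← hyz]
    exact add_mem (Ideal.mem_sup_left (Ideal.mul_mem_left _ _ (Ideal.mem_span_singleton_self s)))
      (Ideal.mem_sup_right hz)
  obtain ⟨a, ha, b, hb, hab⟩ := Submodule.mem_sup.mp ((Ideal.eq_top_iff_one _).mp htop)
  obtain ⟨c, rfl⟩ := Ideal.mem_span_singleton'.mp ha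
  rw [← one_mul x, ← hab, add_mul, mul_assoc]
  exact add_mem (Ideal.mem_sup_left (Ideal.mul_mem_left _ _ hsx))
    (Ideal.mem_sup_right (Ideal.mul_mem_right _ _ hb))

/-- At most `dim M` elements of `𝔪` generate, together with the annihilator of `M`, an ideal that
contains a fixed power of `𝔪` modulo all powers of `𝔪`: lifts of a system of parameters of
`R / Ann M` at the image of `𝔪`. If `𝔪` does not contain `Ann M`, none are needed. -/
theorem Module.exists_finset_card_le_natDim {R M : Type*} [CommRing R] [IsNoetherianRing R]
    [AddCommGroup M] [Module R M] [Module.Finite R M] (𝔪 : Ideal R) [h𝔪 : 𝔪.IsMaximal]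
    (hdim : Module.supportDim R M ≠ ⊤) :
    ∃ (s : Finset R) (t : ℕ), s.card ≤ natDim R M ∧ (∀ x ∈ s, x ∈ 𝔪) ∧ ∀ N : ℕ,
      𝔪 ^ t ≤ Module.annihilator R M ⊔ Ideal.span (s : Set R) ⊔ 𝔪 ^ N := by
  classical
  by_cases hann : Module.annihilator R M ≤ 𝔪
  · let π := Ideal.Quotient.mk (Module.annihilator R M)
    have hπ : Function.Surjective π := Ideal.Quotient.mk_surjective
    have hcomap : (𝔪.map π).comap π = 𝔪 := by
      rw [Ideal.comap_map_quotientMk, sup_eq_right.mpr hann]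
    have hmax : (𝔪.map π).IsMaximal := by
      refine (Ideal.map_eq_top_or_isMaximal_of_surjective π hπ h𝔪).resolve_left fun h => ?_
      exact h𝔪.ne_top (by rw [← hcomap, h, Ideal.comap_top])
    obtain ⟨s, hs, hcard⟩ := (𝔪.map π).exists_finset_card_eq_height_of_isNoetherianRing
    obtain ⟨t, ht⟩ := Ideal.exists_forall_pow_le_sup_pow hs
    have himage : π '' (s.image (Function.surjInv hπ) : Set R) = s := by
      rw [Finset.coe_image, ← Set.image_comp, (Function.rightInverse_surjInv hπ).comp_eq_id,
        Set.image_id]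
    refine ⟨s.image (Function.surjInv hπ), t, Finset.card_image_le.trans ?_, ?_, fun N => ?_⟩
    · have hle : ((s.card : ℕ∞) : WithBot ℕ∞) ≤ Module.supportDim R M := by
        rw [Module.supportDim_eq_ringKrullDim_quotient_annihilator, hcard]
        exact Ideal.height_le_ringKrullDim_of_isPrime
      unfold natDim
      generalize Module.supportDim R M = D at hdim hle
      induction D with
      | bot => simp at hle
      | coe D =>
        induction D with
        | top => exact absurd rfl hdim
        | coe D => exact_mod_cast hle
    · intro x hx
      obtain ⟨y, hy, rfl⟩ := Finset.mem_image.mp hx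
      rw [← hcomap, Ideal.mem_comap, Function.surjInv_eq hπ]
      exact hs.1.2 (Ideal.subset_span hy)
    · have h := Ideal.comap_mono (f := π) (ht N)
      rw [← himage, ← Ideal.map_span, ← Ideal.map_pow, ← Ideal.map_pow, ← Ideal.map_sup,
        Ideal.comap_map_quotientMk, Ideal.comap_map_quotientMk] at h
      rw [sup_assoc]
      exact le_sup_right.trans h
  · refine ⟨∅, 0, by simp, by simp, fun N => ?_⟩
    have h : Module.annihilator R M ⊔ 𝔪 ^ N = ⊤ := by
      apply Ideal.sup_pow_eq_top
      rw [sup_comm]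
      exact h𝔪.1.2 _ (left_lt_sup.mpr hann)
    rw [sup_right_comm, h]
    simp

/-- The Hilbert–Samuel function of `M` at `𝔪` is bounded by a multiple of `n ^ dim M`. -/
theorem Module.exists_length_quotient_pow_smul_le {R M : Type*} [CommRing R] [IsNoetherianRing R]
    [AddCommGroup M] [Module R M] [Module.Finite R M] (𝔪 : Ideal R) [𝔪.IsMaximal]
    (hdim : Module.supportDim R M ≠ ⊤) :
    ∃ C : ℕ, ∀ n : ℕ, Module.length R (M ⧸ (𝔪 ^ n • (⊤ : Submodule R M))) ≤
      ((C * n ^ natDim R M : ℕ) : ℕ∞) := by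
  obtain ⟨s, t, hcard, hs, h⟩ := Module.exists_finset_card_le_natDim (M := M) 𝔪 hdim
  obtain ⟨C, hC⟩ := Module.exists_length_quotient_sup_pow_smul_le 𝔪 t s hs (⊥ : Submodule R M)
    fun N => by
      have hN := Submodule.smul_mono_left (N := (⊤ : Submodule R M)) (h N)
      rwa [Submodule.sup_smul, Submodule.sup_smul, ← Submodule.annihilator_top,
        Submodule.annihilator_smul] at hN
  refine ⟨C, fun n => ?_⟩
  -- `n ^ #s ≤ n ^ dim M` fails for `n = 0` when `#s = 0 < dim M`; there the length is zero.
  rcases Nat.eq_zero_or_pos n with rfl | hn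
  · have : Subsingleton (M ⧸ (𝔪 ^ 0 • (⊤ : Submodule R M))) := by
      rw [Submodule.Quotient.subsingleton_iff]
      simp
    rw [Module.length_eq_zero]
    exact zero_le
  · refine (le_of_eq ?_).trans ((hC n).trans ?_)
    · rw [bot_sup_eq]
    · exact_mod_cast Nat.mul_le_mul_left C (Nat.pow_le_pow_right hn hcard)

/-! ### Length of the zeroth local cohomology -/

/-- If the `J`-power torsion of `M / A` meets `K (M / A)` trivially, it embeds in a quotient of
`M / K M`. -/
theorem length_zerothLocalCohomology_quotient_le {R M : Type*} [CommRing R] [AddCommGroup M]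
    [Module R M] (J K : Ideal R) (A : Submodule R M)
    (h : ∀ x ∈ K • (⊤ : Submodule R M), (∃ k : ℕ, ∀ a ∈ J ^ k, a • x ∈ A) → x ∈ A) :
    Module.length R (zerothLocalCohomology J (M ⧸ A)) ≤
      Module.length R (M ⧸ (K • (⊤ : Submodule R M))) := by
  let f : (M ⧸ (K • (⊤ : Submodule R M))) →ₗ[R] ((M ⧸ A) ⧸ (K • (⊤ : Submodule R (M ⧸ A)))) :=
    Submodule.mapQ _ _ A.mkQ (by
      rw [← Submodule.map_le_iff_le_comap, Submodule.map_smul'']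
      exact smul_mono_right _ le_top)
  have hf : Function.Surjective f := by
    rw [← LinearMap.range_eq_top, Submodule.range_mapQ, A.range_mkQ, Submodule.map_top,
      Submodule.range_mkQ]
  let g : zerothLocalCohomology J (M ⧸ A) →ₗ[R] ((M ⧸ A) ⧸ (K • (⊤ : Submodule R (M ⧸ A)))) :=
    (K • (⊤ : Submodule R (M ⧸ A))).mkQ ∘ₗ (zerothLocalCohomology J (M ⧸ A)).subtype
  refine (Module.length_le_of_injective g ?_).trans (Module.length_le_of_surjective f hf)
  rw [← LinearMap.ker_eq_bot, LinearMap.ker_eq_bot']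
  rintro ⟨q, k, hk⟩ hq
  have hqK : q ∈ K • (⊤ : Submodule R (M ⧸ A)) := (Submodule.Quotient.mk_eq_zero _).mp hq
  rw [← A.range_mkQ, LinearMap.range_eq_map, ← Submodule.map_smul''] at hqK
  obtain ⟨x, hx, rfl⟩ := hqK
  refine Subtype.ext ((Submodule.Quotient.mk_eq_zero A).mpr (h x hx ⟨k, fun a ha => ?_⟩))
  exact (Submodule.Quotient.mk_eq_zero A).mp (hk a ha)

theorem Ideal.Filtration.IsFilteredModule.exists_length_zerothLocalCohomology_le
    {R M : Type*} [CommRing R] [IsNoetherianRing R] [AddCommGroup M] [Module R M]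
    [Module.Finite R M] {I : Ideal R} {F : I.Filtration M} (hF : F.IsFilteredModule)
    (𝔪 : Ideal R) [𝔪.IsMaximal] (hdim : Module.supportDim R M ≠ ⊤) :
    ∃ C : ℕ, ∀ n : ℕ, Module.length R (zerothLocalCohomology 𝔪 (M ⧸ F.N n)) ≤
      ((C * n ^ natDim R M : ℕ) : ℕ∞) := by
  obtain ⟨c, hc⟩ := F.exists_torsion_mem_of_mem_pow_smul hF.fg hF.zero_eq_top 𝔪
  obtain ⟨C, hC⟩ := Module.exists_length_quotient_pow_smul_le (M := M) 𝔪 hdim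
  refine ⟨C * c ^ natDim R M, fun n => ?_⟩
  rw [mul_assoc, ← mul_pow]
  exact (length_zerothLocalCohomology_quotient_le 𝔪 _ (F.N n) (hc n)).trans (hC (c * n))

theorem Ideal.isFilteredModule_stableFiltration_top {R M : Type*} [CommRing R]
    [IsNoetherianRing R] [AddCommGroup M] [Module R M] [Module.Finite R M] (I : Ideal R) :
    (I.stableFiltration (⊤ : Submodule R M)).IsFilteredModule where
  zero_eq_top := by simp
  fg := (Ideal.Filtration.submodule_fg_iff_stable _ fun _ => IsNoetherian.noetherian _).mpr
    (I.stableFiltration_stable ⊤)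

theorem mainTheorem6 {R : Type*} [CommRing R] [IsNoetherianRing R] (𝔪 : Ideal R) [𝔪.IsMaximal]
    (I : Ideal R) {M : Type*} [AddCommGroup M] [Module R M] [Module.Finite R M]
    (hdim : Module.supportDim R M ≠ ⊤) :
    (∀ F : I.Filtration M, F.IsFilteredModule →
      (∀ n : ℕ, Module.length R (zerothLocalCohomology 𝔪 (M ⧸ F.N n)) ≠ ⊤) ∧
      (fun n : ℕ => ((Module.length R (zerothLocalCohomology 𝔪 (M ⧸ F.N n))).toNat : ℝ))
        =O[atTop] (fun n : ℕ => (n : ℝ) ^ natDim R M)) ∧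
    epsilonMultiplicity 𝔪 I M < ⊤ := by
  refine ⟨fun F hF => ?_, ?_⟩
  · obtain ⟨C, hC⟩ := hF.exists_length_zerothLocalCohomology_le 𝔪 hdim
    refine ⟨fun n => ne_top_of_le_ne_top (ENat.natCast_ne_top _) (hC n), ?_⟩
    refine IsBigO.of_bound (C : ℝ) (Eventually.of_forall fun n => ?_)
    rw [Real.norm_of_nonneg (by positivity), Real.norm_of_nonneg (by positivity)]
    exact_mod_cast ENat.toNat_le_of_le_natCast (hC n)
  · obtain ⟨C, hC⟩ := (I.isFilteredModule_stableFiltration_top (M := M)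
      ).exists_length_zerothLocalCohomology_le 𝔪 hdim
    have hbound : epsilonMultiplicity 𝔪 I M ≤ ((natDim R M)! * C : ℕ) := by
      refine limsup_le_of_le (by isBoundedDefault) ?_
      filter_upwards [eventually_gt_atTop 0] with n hn
      refine ENNReal.div_le_of_le_mul ?_
      have h : (Module.length R (zerothLocalCohomology 𝔪
          (M ⧸ (I ^ n • (⊤ : Submodule R M)))) : ℝ≥0∞) ≤ ((C * n ^ natDim R M : ℕ) : ℝ≥0∞) := by
        exact_mod_cast ENat.toENNReal_le.mpr (hC n)
      refine (mul_le_mul_right h _).trans (le_of_eq ?_)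
      push_cast
      ring
    exact hbound.trans_lt (ENNReal.natCast_lt_top _)
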